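/- Let $\lambda,\xi>0$ and $v_2<v_1$ be real numbers. A geometric counting process (GCP) with intensity $\lambda$ is a mixed Poisson process whose random rate is exponentially distributed with mean $\lambda$. Fix $j\in\{1,2\}$. Without resets, a particle starts at the origin with velocity $v_j$ and its velocity alternates between $v_1$ and $v_2$; the successive durations of the phases with velocity $v_1$ and those of the phases with velocity $v_2$ are the intertimes of two independent GCPs with intensity $\lambda$. Now let the particle in addition be reset instantaneously to the origin at the epochs of an independent Poisson process with intensity $\xi$, the motion starting afresh with velocity $v_j$ after each reset: it is again driven, as above, by two independent GCPs with intensity $\lambda$, which are independent of the reset process. Let $\tilde X(t)$ be the position of the particle at time $t$, and let ${\rm E}_j$ denote expectation when the initial velocity is $v_j$. Put $$G_\xi(t)=\Gamma\Big(0,\frac{\xi}{\lambda},\frac{\xi}{\lambda}(1+\lambda t)\Big),\qquad \Gamma(a,z_0,z_1)=\int_{z_0}^{z_1}u^{a-1}e^{-u}\,{\rm d}u .$$ Then, for every $t>0$ and $j=1,2$, the variables $\tilde X(t)$ and $\tilde X^2(t)$ are integrable and $${\rm E}_j[\tilde X(t)]=(1-e^{-\xi t})\Big(\frac{v_1+v_2}{2\xi}+\frac{v_j-v_{3-j}}{2\lambda}\Big)-\frac{\xi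 e^{\xi/\lambda}(v_j-v_{3-j})}{2\lambda^2}G_\xi(t)+\frac{t e^{-\xi t}(v_j-v_{3-j})}{2(1+\lambda t)},$$ $$\begin{aligned}{\rm E}_j[\tilde X^2(t)]={}&(1-e^{-\xi t})\Big[\frac{2(v_1^2+v_1v_2+v_2^2)}{3\xi^2}+\frac{2v_j^2-v_1v_2-v_{3-j}^2}{3\lambda}\Big(\frac1\xi-\frac1\lambda\Big)\Big]\\&-te^{-\xi t}\Big[\frac{2(v_1^2+v_1v_2+v_2^2)}{3\xi}+\frac{2v_j^2-v_1v_2-v_{3-j}^2}{3\lambda(1+\lambda t)}\Big]+\frac{\xi e^{\xi/\lambda}(2v_j^2-v_1v_2-v_{3-j}^2)}{3\lambda^3}G_\xi(t).\end{aligned}$$ -/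

import Mathlib

open MeasureTheory ProbabilityTheory

noncomputable section

/-- The generalized incomplete Gamma function `Γ(a, z₀, z₁) = ∫_{z₀}^{z₁} u^{a-1} e^{-u} du`. -/
def genIncGamma (a z₀ z₁ : ℝ) : ℝ :=
  ∫ u in z₀..z₁, u ^ (a - 1) * Real.exp (-u)

/-- The `n`-th epoch `d 0 + ⋯ + d (n-1)` of a sequence of durations (`epoch d 0 = 0`). -/
def epoch (d : ℕ → ℝ) (n : ℕ) : ℝ := ∑ i ∈ Finset.range n, d i

/-- The number of epochs `T₁, T₂, …` in `(s, t]`, i.e. the increment `N(t) - N(s)` of the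
associated counting process. It takes values in `ℕ∞`. -/
def epochCount (d : ℕ → ℝ) (s t : ℝ) : ℕ∞ :=
  {n : ℕ | epoch d (n + 1) ∈ Set.Ioc s t}.encard

/-- The number of epochs `T₁, T₂, …` in `[0, t]`, as a natural number: the counting process `N(t)`.
(It is finite almost surely for all processes below.) -/
def counting (d : ℕ → ℝ) (t : ℝ) : ℕ :=
  {n : ℕ | epoch d (n + 1) ≤ t}.ncard

/-- `D` is the sequence of intertimes of a mixed Poisson process with mixing distribution `μ`:
the intertimes are a.s. positive, and the joint law of the increments of the counting process over
consecutive intervals is the `μ`-mixture over the rate `α` of the laws of the increments of a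
Poisson process of rate `α`. -/
structure IsMixedPoisson {Ω : Type*} [MeasurableSpace Ω] (P : Measure Ω) (μ : Measure ℝ)
    (D : ℕ → Ω → ℝ) : Prop where
  measurable : ∀ n, Measurable (D n)
  pos : ∀ᵐ ω ∂P, ∀ n, 0 < D n ω
  law : ∀ (m : ℕ) (t : Fin (m + 1) → ℝ) (k : Fin m → ℕ), Monotone t → 0 ≤ t 0 →
    P {ω | ∀ i : Fin m, epochCount (fun n => D n ω) (t i.castSucc) (t i.succ) = (k i : ℕ∞)} =
      ∫⁻ α, ∏ i : Fin m,
        poissonMeasure (Real.toNNReal (α * (t i.succ - t i.castSucc))) {k i} ∂μ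

/-- `D` is the sequence of intertimes of a Poisson process with intensity `r`. -/
def IsPoissonProcess {Ω : Type*} [MeasurableSpace Ω] (P : Measure Ω) (r : ℝ)
    (D : ℕ → Ω → ℝ) : Prop :=
  IsMixedPoisson P (Measure.dirac r) D

/-- `D` is the sequence of intertimes of a geometric counting process with intensity `lam`: a
mixed Poisson process whose random rate is exponential with mean `lam`. -/
def IsGCP {Ω : Type*} [MeasurableSpace Ω] (P : Measure Ω) (lam : ℝ)
    (D : ℕ → Ω → ℝ) : Prop :=
  IsMixedPoisson P (expMeasure (1 / lam)) D

/-- Durations of the successive phases of constant velocity: the phases alternate between the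
two velocities, starting with velocity number `j`; the successive phases with velocity number `i`
have durations `u i 0, u i 1, …`. -/
def phaseDuration (j : Fin 2) (u : Fin 2 → ℕ → ℝ) (n : ℕ) : ℝ :=
  if Even n then u j (n / 2) else u (j + 1) (n / 2)

/-- The velocity `V(s) = (v₁+v₂)/2 + (-1)^{j-1} (v₁-v₂)/2 (-1)^{N(s)}` without resets, where `N`
is the alternating counting process. The index `j : Fin 2` is zero-based, so that `j = 0` is the
initial velocity `v₁` and `j = 1` the initial velocity `v₂`. -/
def telegraphVelocity (v₁ v₂ : ℝ) (j : Fin 2) (u : Fin 2 → ℕ → ℝ) (s : ℝ) : ℝ :=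
  (v₁ + v₂) / 2 + (-1) ^ (j : ℕ) * ((v₁ - v₂) / 2) * (-1) ^ counting (phaseDuration j u) s

/-- The position `X(t) = ∫₀ᵗ V(s) ds` without resets. -/
def telegraphPosition (v₁ v₂ : ℝ) (j : Fin 2) (u : Fin 2 → ℕ → ℝ) (t : ℝ) : ℝ :=
  ∫ s in (0 : ℝ)..t, telegraphVelocity v₁ v₂ j u s

/-- The position `X̃(t)` with resets to the origin at the epochs of the sequence `r`. After the
`k`-th reset the motion restarts from the origin with velocity number `j` and runs with the phase
durations `u k`. -/
def resetPosition (v₁ v₂ : ℝ) (j : Fin 2) (r : ℕ → ℝ) (u : ℕ → Fin 2 → ℕ → ℝ) (t : ℝ) : ℝ :=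
  telegraphPosition v₁ v₂ j (u (counting r t)) (t - epoch r (counting r t))

/-- The random inputs of the telegraph process with underlying GCP's of intensity `lam`, subject to
resets to the origin with intensity `ξ`: `R` are the times between resets, and `U k i` are the
durations of the phases with velocity number `i` after the `k`-th reset (before the first
reset for `k = 0`).

Resets are paced by a Poisson process; between resets the velocity alternates according to two
independent GCP's, which are independent of the resets. Nothing is required of the joint law of the
motions after different resets: these may for instance be independent copies of each other, or keep
the same random rates. -/
structure IsResetTelegraph {Ω : Type*} [MeasurableSpace Ω] (P : Measure Ω) (lam ξ : ℝ)
    (R : ℕ → Ω → ℝ) (U : ℕ → Fin 2 → ℕ → Ω → ℝ) : Prop where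
  resets : IsPoissonProcess P ξ R
  gcp : ∀ k i, IsGCP P lam (U k i)
  indep_gcp : ∀ k, IndepFun (fun ω n => U k 0 n ω) (fun ω n => U k 1 n ω) P
  indep_resets : ∀ k, IndepFun (fun ω n => R n ω) (fun ω i n => U k i n ω) P

end

/-! Without resets the position at time `s` is affine in the single random variable A, the time
spent so far in the initial velocity. Running the two clocks separately, A ≥ a holds, up to ties,
exactly when N_j(a) ≤ N_{j+1}(s - a) (`initialPhaseTime_spec`). Counts of a GCP are geometric, with
ratio λa/(1+λa) at time a, so independence and a geometric series give P(A ≥ a) = (1+λ(s-a))/(1+λs),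
which is linear in a. The tail formula `integral_comp_eq_integral_tail` turns this into the first
two moments m(s) of the free motion.

With resets, the position at `t` is that of a free motion run for the age B, the time since the last
reset. B lies in [0, t], and B ≥ s means that no reset falls in (t - s, t], an event of probability
exp(-ξs). Splitting by the number k of resets and using that the k-th motion is independent of the
resets, the moment is E[m(B)] (`IsResetTelegraph.integral_pow`). The tail formula again, with m(0) =
0, gives ∫₀ᵗ exp(-ξs) m'(s) ds. The stated closed forms vanish at t = 0 and have this integrand as
derivative; the incomplete Gamma function comes from integrating exp(-ξs)/(1+λs). -/

noncomputable section

/-! ### Deterministic theory of epochs and counting. -/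

/-- Positive durations whose partial sums are unbounded. -/
structure IsProperDurations (d : ℕ → ℝ) : Prop where
  pos : ∀ n, 0 < d n
  exists_lt : ∀ s, ∃ n, s < epoch d n

@[simp] lemma epoch_zero (d : ℕ → ℝ) : epoch d 0 = 0 := by simp [epoch]

lemma epoch_succ (d : ℕ → ℝ) (n : ℕ) : epoch d (n + 1) = epoch d n + d n :=
  Finset.sum_range_succ _ _

lemma strictMono_epoch {d : ℕ → ℝ} (hd : ∀ n, 0 < d n) : StrictMono (epoch d) :=
  strictMono_nat_of_lt_succ fun n => by rw [epoch_succ]; linarith [hd n]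

lemma epoch_nonneg {d : ℕ → ℝ} (hd : ∀ n, 0 < d n) (n : ℕ) : 0 ≤ epoch d n := by
  simpa using (strictMono_epoch hd).monotone (Nat.zero_le n)

/-- Bridge from `counting`, used to build paths, to `epochCount`, whose law is prescribed: all
epochs are positive, so excluding 0 loses nothing. -/
lemma counting_eq_toNat_epochCount {d : ℕ → ℝ} (hd : ∀ n, 0 < d n) (s : ℝ) :
    counting d s = (epochCount d 0 s).toNat := by
  rw [counting, epochCount, Set.ncard_def]
  congr 2
  ext n
  have : 0 < epoch d (n + 1) := by
    simpa using strictMono_epoch hd (Nat.succ_pos n)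
  simp [this]

namespace IsProperDurations

variable {d : ℕ → ℝ}

lemma counting_eq_of_mem (hd : IsProperDurations d) {s : ℝ} {k : ℕ}
    (h₁ : epoch d k ≤ s) (h₂ : s < epoch d (k + 1)) : counting d s = k := by
  have hm := (strictMono_epoch hd.pos)
  have : {n : ℕ | epoch d (n + 1) ≤ s} = Set.Iio k := by
    ext n
    constructor
    · intro h
      have := hm.lt_iff_lt.1 (lt_of_le_of_lt h h₂)
      simp only [Set.mem_Iio]
      omega
    · intro h
      exact (hm.monotone (Nat.succ_le_of_lt h)).trans h₁
  rw [counting, this, Set.ncard_eq_toFinset_card', Set.toFinset_Iio, Nat.card_Iio]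

lemma exists_mem (hd : IsProperDurations d) {s : ℝ} (hs : 0 ≤ s) :
    ∃ k, epoch d k ≤ s ∧ s < epoch d (k + 1) := by
  classical
  have hex := hd.exists_lt s
  have h1 := Nat.find_spec hex
  have h0 : Nat.find hex ≠ 0 := by
    intro h
    rw [h, epoch_zero] at h1
    linarith
  obtain ⟨k, hk⟩ := Nat.exists_eq_succ_of_ne_zero h0
  refine ⟨k, not_lt.1 (Nat.find_min hex (by omega)), ?_⟩
  rw [hk] at h1
  exact h1

lemma counting_eq_iff (hd : IsProperDurations d) {s : ℝ} (hs : 0 ≤ s) {k : ℕ} :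
    counting d s = k ↔ epoch d k ≤ s ∧ s < epoch d (k + 1) := by
  constructor
  · rintro rfl
    obtain ⟨k, hk⟩ := hd.exists_mem hs
    rwa [hd.counting_eq_of_mem hk.1 hk.2]
  · exact fun h => hd.counting_eq_of_mem h.1 h.2

lemma epoch_counting_le (hd : IsProperDurations d) {s : ℝ} (hs : 0 ≤ s) :
    epoch d (counting d s) ≤ s := ((hd.counting_eq_iff hs).1 rfl).1

lemma lt_epoch_counting (hd : IsProperDurations d) {s : ℝ} (hs : 0 ≤ s) :
    s < epoch d (counting d s + 1) := ((hd.counting_eq_iff hs).1 rfl).2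

lemma le_counting_iff (hd : IsProperDurations d) {s : ℝ} (hs : 0 ≤ s) {k : ℕ} :
    k ≤ counting d s ↔ epoch d k ≤ s := by
  have hm := strictMono_epoch hd.pos
  constructor
  · exact fun h => (hm.monotone h).trans (hd.epoch_counting_le hs)
  · intro h
    exact Nat.le_of_lt_succ (hm.lt_iff_lt.1 (h.trans_lt (hd.lt_epoch_counting hs)))

/-- Only the last epoch before `t` can matter. This turns the tail of the age into a void
probability. -/
lemma epochCount_eq_zero_iff (hd : IsProperDurations d) {s t : ℝ} (hs : 0 ≤ s) (hst : s ≤ t) :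
    epochCount d s t = 0 ↔ epoch d (counting d t) ≤ s := by
  have hm := strictMono_epoch hd.pos
  have ht := hs.trans hst
  rw [epochCount, Set.encard_eq_zero, Set.eq_empty_iff_forall_notMem]
  constructor
  · intro h
    rcases hk : counting d t with _ | k
    · simpa using hs
    · by_contra hlt
      exact h k ⟨not_le.1 hlt, by rw [← hk]; exact hd.epoch_counting_le ht⟩
  · rintro h n ⟨h1, h2⟩
    have := (hd.le_counting_iff ht).2 h2
    linarith [hm.monotone this]

end IsProperDurations

lemma measurable_epoch (n : ℕ) : Measurable fun d : ℕ → ℝ => epoch d n := by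
  unfold epoch
  fun_prop

lemma measurable_counting : Measurable fun p : (ℕ → ℝ) × ℝ => counting p.1 p.2 := by
  refine measurable_ncard.comp (measurable_set_iff.2 fun n => ?_)
  exact measurableSet_setOfPred.1
    (measurableSet_le ((measurable_epoch (n + 1)).comp measurable_fst) measurable_snd)

lemma measurable_phaseDuration (j : Fin 2) :
    Measurable fun u : Fin 2 → ℕ → ℝ => phaseDuration j u := by
  refine measurable_pi_lambda _ fun n => ?_
  unfold phaseDuration
  split_ifs <;> fun_prop

/-! ### Time spent in the initial velocity, path by path. -/

/-- The difference between the total durations of the even and of the odd phases up to time `s`. -/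
def phaseBalance (d : ℕ → ℝ) (s : ℝ) : ℝ := ∫ x in (0 : ℝ)..s, (-1) ^ counting d x

lemma measurable_counting_right (d : ℕ → ℝ) : Measurable (counting d) :=
  Measurable.of_uncurry_left (f := counting) measurable_counting

lemma intervalIntegrable_neg_one_pow_counting (d : ℕ → ℝ) (a b : ℝ) :
    IntervalIntegrable (fun x => (-1 : ℝ) ^ counting d x) volume a b := by
  have hm : Measurable fun x => (-1 : ℝ) ^ counting d x :=
    (Measurable.of_discrete (f := fun n : ℕ => (-1 : ℝ) ^ n)).comp (measurable_counting_right d)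
  refine (intervalIntegrable_const (c := (1 : ℝ))).mono_fun hm.aestronglyMeasurable ?_
  exact Filter.Eventually.of_forall fun x => by simp

/-- The integrand is constant between consecutive epochs. The right endpoint is included so that the
induction can evaluate at the next epoch. -/
lemma IsProperDurations.phaseBalance_of_mem {d : ℕ → ℝ} (hd : IsProperDurations d) (k : ℕ) :
    ∀ s, epoch d k ≤ s → s ≤ epoch d (k + 1) →
      phaseBalance d s = ∑ i ∈ Finset.range k, (-1) ^ i * d i + (-1) ^ k * (s - epoch d k) := by
  have hstep : ∀ k s, epoch d k ≤ s → s ≤ epoch d (k + 1) →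
      phaseBalance d s = phaseBalance d (epoch d k) + (-1) ^ k * (s - epoch d k) := by
    intro k s h1 h2
    have hi := intervalIntegrable_neg_one_pow_counting d
    have : ∫ x in epoch d k..s, (-1 : ℝ) ^ counting d x = ∫ x in epoch d k..s, (-1 : ℝ) ^ k := by
      -- The count equals `k` on the half-open interval closed on the left, hence the passage from
      -- `Ioc` to `Ico`.
      rw [intervalIntegral.integral_of_le h1, intervalIntegral.integral_of_le h1,
        ← integral_Ico_eq_integral_Ioc, ← integral_Ico_eq_integral_Ioc]
      refine setIntegral_congr_fun measurableSet_Ico fun x hx => ?_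
      simp only [hd.counting_eq_of_mem hx.1 (hx.2.trans_le h2)]
    rw [phaseBalance, ← intervalIntegral.integral_add_adjacent_intervals (hi 0 (epoch d k))
      (hi (epoch d k) s), this, intervalIntegral.integral_const, smul_eq_mul, phaseBalance]
    ring
  induction k with
  | zero =>
    intro s h1 h2
    rw [hstep 0 s h1 h2]
    simp [phaseBalance]
  | succ k ih =>
    intro s h1 h2
    have hle : epoch d k ≤ epoch d (k + 1) := (strictMono_epoch hd.pos).monotone (Nat.le_succ k)
    rw [hstep (k + 1) s h1 h2, ih _ hle le_rfl, Finset.sum_range_succ, epoch_succ]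
    ring

/-- The time up to `s` spent in the phases with the initial velocity. -/
def initialPhaseTime (j : Fin 2) (u : Fin 2 → ℕ → ℝ) (s : ℝ) : ℝ :=
  (s + phaseBalance (phaseDuration j u) s) / 2

lemma phaseDuration_two_mul (j : Fin 2) (u : Fin 2 → ℕ → ℝ) (n : ℕ) :
    phaseDuration j u (2 * n) = u j n := by
  simp [phaseDuration]

lemma phaseDuration_two_mul_add_one (j : Fin 2) (u : Fin 2 → ℕ → ℝ) (n : ℕ) :
    phaseDuration j u (2 * n + 1) = u (j + 1) n := by
  have : (2 * n + 1) / 2 = n := by omega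
  simp [phaseDuration, this]

lemma epoch_phaseDuration_two_mul (j : Fin 2) (u : Fin 2 → ℕ → ℝ) (n : ℕ) :
    epoch (phaseDuration j u) (2 * n) = epoch (u j) n + epoch (u (j + 1)) n := by
  induction n with
  | zero => simp
  | succ n ih =>
    rw [show 2 * (n + 1) = 2 * n + 1 + 1 by ring, epoch_succ, epoch_succ, ih, epoch_succ, epoch_succ,
      phaseDuration_two_mul, phaseDuration_two_mul_add_one]
    ring

lemma alternatingSum_phaseDuration_two_mul (j : Fin 2) (u : Fin 2 → ℕ → ℝ) (n : ℕ) :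
    ∑ i ∈ Finset.range (2 * n), (-1) ^ i * phaseDuration j u i =
      epoch (u j) n - epoch (u (j + 1)) n := by
  induction n with
  | zero => simp
  | succ n ih =>
    rw [show 2 * (n + 1) = 2 * n + 1 + 1 by ring, Finset.sum_range_succ, Finset.sum_range_succ, ih,
      epoch_succ, epoch_succ, phaseDuration_two_mul, phaseDuration_two_mul_add_one,
      pow_succ, pow_mul]
    norm_num
    ring

lemma isProperDurations_phaseDuration {j : Fin 2} {u : Fin 2 → ℕ → ℝ}
    (hu : ∀ i, IsProperDurations (u i)) : IsProperDurations (phaseDuration j u) where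
  pos n := by
    unfold phaseDuration
    split_ifs
    exacts [(hu _).pos _, (hu _).pos _]
  exists_lt s := by
    obtain ⟨n, hn⟩ := (hu j).exists_lt s
    refine ⟨2 * n, ?_⟩
    rw [epoch_phaseDuration_two_mul]
    linarith [epoch_nonneg (hu (j + 1)).pos n]

/-- The time spent in the initial velocity is the smallest `a` such that the phases with the other
velocity started before the clock of the first kind shows `a` fill the remaining time `s - a`. -/
lemma initialPhaseTime_spec {j : Fin 2} {u : Fin 2 → ℕ → ℝ} (hu : ∀ i, IsProperDurations (u i))
    {s a : ℝ} (ha : 0 ≤ a) (has : a ≤ s) :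
    (a < initialPhaseTime j u s → counting (u j) a ≤ counting (u (j + 1)) (s - a)) ∧
      (counting (u j) a ≤ counting (u (j + 1)) (s - a) → a ≤ initialPhaseTime j u s) := by
  have hd := isProperDurations_phaseDuration (j := j) hu
  have h₁ := strictMono_epoch (hu j).pos
  have h₂ := strictMono_epoch (hu (j + 1)).pos
  have hsa : 0 ≤ s - a := sub_nonneg.2 has
  rw [(hu (j + 1)).le_counting_iff hsa]
  have c₁ := (hu j).epoch_counting_le ha
  have c₂ := (hu j).lt_epoch_counting ha
  obtain ⟨k, hk₁, hk₂⟩ := hd.exists_mem (ha.trans has)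
  have hb := hd.phaseBalance_of_mem k s hk₁ hk₂.le
  unfold initialPhaseTime
  rw [hb]
  -- For k = 2n the particle is in its initial velocity, the other clock has stopped at its n-th
  -- epoch, and the time sought is `s - epoch (u (j + 1)) n`. For k = 2n + 1 the first clock has
  -- stopped at `epoch (u j) (n + 1)`, which is the time sought.
  obtain ⟨n, rfl | rfl⟩ := Nat.even_or_odd' k
  · rw [epoch_succ, epoch_phaseDuration_two_mul, phaseDuration_two_mul] at hk₂
    rw [epoch_phaseDuration_two_mul] at hk₁
    rw [alternatingSum_phaseDuration_two_mul, epoch_phaseDuration_two_mul, pow_mul]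
    norm_num
    have he := epoch_succ (u j) n
    constructor
    · intro h
      have : counting (u j) a ≤ n := by
        by_contra hlt
        have := h₁.monotone (show n + 1 ≤ counting (u j) a by omega)
        linarith
      linarith [h₂.monotone this]
    · intro h
      by_contra hlt
      have : n ≤ counting (u j) a := ((hu j).le_counting_iff ha).2 (by linarith)
      linarith [h₂.monotone this]
  · rw [show 2 * n + 1 + 1 = 2 * (n + 1) by ring, epoch_phaseDuration_two_mul] at hk₂
    rw [epoch_succ, epoch_phaseDuration_two_mul, phaseDuration_two_mul] at hk₁
    rw [Finset.sum_range_succ, alternatingSum_phaseDuration_two_mul, epoch_succ,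
      epoch_phaseDuration_two_mul, phaseDuration_two_mul, pow_succ, pow_mul]
    norm_num
    have he := epoch_succ (u j) n
    constructor
    · intro h
      have : counting (u j) a ≤ n := by
        by_contra hlt
        have := h₁.monotone (show n + 1 ≤ counting (u j) a by omega)
        linarith
      linarith [h₂.monotone this]
    · intro h
      by_contra hlt
      have : n + 1 ≤ counting (u j) a := ((hu j).le_counting_iff ha).2 (by linarith)
      linarith [h₂.monotone this]

lemma abs_phaseBalance_le (d : ℕ → ℝ) (s : ℝ) : |phaseBalance d s| ≤ |s| := by
  have := intervalIntegral.norm_integral_le_of_norm_le_const (a := 0) (b := s) (C := 1)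
    (f := fun x => (-1 : ℝ) ^ counting d x) fun x _ => by simp
  simpa [phaseBalance] using this

lemma initialPhaseTime_mem_Icc (j : Fin 2) (u : Fin 2 → ℕ → ℝ) {s : ℝ} (hs : 0 ≤ s) :
    initialPhaseTime j u s ∈ Set.Icc 0 s := by
  have := abs_phaseBalance_le (phaseDuration j u) s
  rw [abs_of_nonneg hs, abs_le] at this
  constructor <;> unfold initialPhaseTime <;> linarith [this.1, this.2]

lemma measurable_phaseBalance :
    Measurable fun p : (ℕ → ℝ) × ℝ => phaseBalance p.1 p.2 := by
  -- An indicator moves the variable limits into the integrand, leaving a parametric integral over a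
  -- fixed measure; the interval integral is the difference of its two orientations.
  have key : ∀ (a b : ((ℕ → ℝ) × ℝ) → ℝ), Measurable a → Measurable b →
      Measurable fun p => ∫ x in Set.Ioc (a p) (b p), (-1 : ℝ) ^ counting p.1 x := by
    intro a b ha hb
    have h1 : Measurable fun q : ((ℕ → ℝ) × ℝ) × ℝ => (-1 : ℝ) ^ counting q.1.1 q.2 :=
      (Measurable.of_discrete (f := fun n : ℕ => (-1 : ℝ) ^ n)).comp
        (measurable_counting.comp ((measurable_fst.comp measurable_fst).prodMk measurable_snd))
    have hS : MeasurableSet {q : ((ℕ → ℝ) × ℝ) × ℝ | a q.1 < q.2 ∧ q.2 ≤ b q.1} :=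
      (measurableSet_lt (ha.comp measurable_fst) measurable_snd).inter
        (measurableSet_le measurable_snd (hb.comp measurable_fst))
    have h2 := (StronglyMeasurable.integral_prod_right (ν := (volume : Measure ℝ))
      (f := fun p x => Set.indicator {q : ((ℕ → ℝ) × ℝ) × ℝ | a q.1 < q.2 ∧ q.2 ≤ b q.1}
        (fun q => (-1 : ℝ) ^ counting q.1.1 q.2) (p, x))
      (h1.indicator hS).stronglyMeasurable).measurable
    convert h2 using 2 with p
    rw [← integral_indicator measurableSet_Ioc]
    rfl
  exact (key (fun _ => 0) Prod.snd measurable_const measurable_snd).sub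
    (key Prod.snd (fun _ => 0) measurable_snd measurable_const)

lemma measurable_initialPhaseTime (j : Fin 2) :
    Measurable fun p : (Fin 2 → ℕ → ℝ) × ℝ => initialPhaseTime j p.1 p.2 := by
  have := measurable_phaseBalance.comp
    (((measurable_phaseDuration j).comp measurable_fst).prodMk measurable_snd)
  exact (measurable_snd.add this).div_const 2

/-- The remaining time `s - initialPhaseTime j u s` is spent in the other velocity, so all
randomness sits in one variable. -/
lemma telegraphPosition_eq (v₁ v₂ : ℝ) (j : Fin 2) (u : Fin 2 → ℕ → ℝ) (s : ℝ) :
    telegraphPosition v₁ v₂ j u s = (if j = 0 then v₂ else v₁) * s +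
      ((if j = 0 then v₁ else v₂) - (if j = 0 then v₂ else v₁)) * initialPhaseTime j u s := by
  have : telegraphPosition v₁ v₂ j u s = (v₁ + v₂) / 2 * s +
      (-1) ^ (j : ℕ) * ((v₁ - v₂) / 2) * phaseBalance (phaseDuration j u) s := by
    unfold telegraphPosition telegraphVelocity phaseBalance
    rw [intervalIntegral.integral_add intervalIntegrable_const
      ((intervalIntegrable_neg_one_pow_counting _ _ _).const_mul _),
      intervalIntegral.integral_const_mul, intervalIntegral.integral_const, smul_eq_mul]
    ring
  rw [this, initialPhaseTime]
  fin_cases j <;> simp <;> ring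

end

/-! ### Laws of mixed Poisson counts, and moments of the motion without resets. -/

noncomputable section

lemma measurable_epochCount (s t : ℝ) : Measurable fun d : ℕ → ℝ => epochCount d s t := by
  refine measurable_encard.comp (measurable_set_iff.2 fun n => ?_)
  exact measurableSet_setOfPred.1 (measurable_epoch (n + 1) measurableSet_Ioc)

lemma measurable_poissonMeasure_singleton (c : ℝ) (k : ℕ) :
    Measurable fun α : ℝ => poissonMeasure (Real.toNNReal (α * c)) {k} := by
  simp_rw [poissonMeasure_singleton]
  fun_prop

section

variable {Ω : Type*} [MeasurableSpace Ω] {P : Measure Ω} {μ : Measure ℝ} {D : ℕ → Ω → ℝ}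

lemma IsMixedPoisson.measurable_durations (h : IsMixedPoisson P μ D) :
    Measurable fun ω n => D n ω :=
  measurable_pi_lambda _ h.measurable

lemma IsMixedPoisson.measure_epochCount (h : IsMixedPoisson P μ D) {s t : ℝ} (hs : 0 ≤ s)
    (hst : s ≤ t) (k : ℕ) :
    P {ω | epochCount (fun n => D n ω) s t = k} =
      ∫⁻ α, poissonMeasure (Real.toNNReal (α * (t - s))) {k} ∂μ := by
  have hmono : Monotone ![s, t] := by
    rw [Fin.monotone_iff_le_succ]
    intro i
    fin_cases i
    simpa using hst
  simpa using h.law 1 ![s, t] (fun _ => k) hmono (by simpa using hs)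

/-- No explosion: the prescribed probabilities of the finite counts on (0, m] already sum to 1, so
almost surely each such interval holds finitely many epochs and some epoch lies beyond `m`. -/
lemma IsMixedPoisson.ae_isProperDurations [IsProbabilityMeasure P] [IsProbabilityMeasure μ]
    (h : IsMixedPoisson P μ D) : ∀ᵐ ω ∂P, IsProperDurations fun n => D n ω := by
  have hfin : ∀ m : ℕ, ∀ᵐ ω ∂P, ∃ k : ℕ, epochCount (fun n => D n ω) 0 m = k := by
    intro m
    have hmeas : ∀ k : ℕ, MeasurableSet {ω | epochCount (fun n => D n ω) 0 m = k} := fun k =>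
      ((measurable_epochCount 0 m).comp h.measurable_durations) (measurableSet_singleton (k : ℕ∞))
    have hU : {ω | ∃ k : ℕ, epochCount (fun n => D n ω) 0 m = k} =
        ⋃ k : ℕ, {ω | epochCount (fun n => D n ω) 0 m = k} := by
      ext ω; simp
    have hone : P {ω | ∃ k : ℕ, epochCount (fun n => D n ω) 0 m = k} = 1 := by
      rw [hU, measure_iUnion _ hmeas]
      · simp_rw [h.measure_epochCount le_rfl (Nat.cast_nonneg m)]
        rw [← lintegral_tsum fun k => (measurable_poissonMeasure_singleton _ k).aemeasurable]
        have : ∀ r, ∑' k, poissonMeasure r {k} = 1 := by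
          intro r
          have hd : Pairwise (Function.onFun Disjoint fun k : ℕ => ({k} : Set ℕ)) :=
            fun i j hij => Set.disjoint_singleton.2 hij
          rw [← measure_iUnion hd fun k => measurableSet_singleton k, Set.iUnion_of_singleton,
            measure_univ]
        simp [this]
      · intro i j hij
        refine Set.disjoint_left.2 fun ω h1 h2 => hij ?_
        have h1' : epochCount (fun n => D n ω) 0 m = i := h1
        have h2' : epochCount (fun n => D n ω) 0 m = j := h2
        exact_mod_cast h1'.symm.trans h2'
    have hset : MeasurableSet {ω | ∃ k : ℕ, epochCount (fun n => D n ω) 0 m = k} := by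
      rw [hU]
      exact MeasurableSet.iUnion hmeas
    exact (prob_compl_eq_zero_iff hset).2 hone
  filter_upwards [h.pos, ae_all_iff.2 hfin] with ω hpos hω
  refine ⟨hpos, fun s => ?_⟩
  obtain ⟨m, hm⟩ := exists_nat_gt s
  obtain ⟨k, hk⟩ := hω m
  have hS : {n : ℕ | epoch (fun n => D n ω) (n + 1) ∈ Set.Ioc 0 (m : ℝ)}.Finite :=
    Set.finite_of_encard_eq_coe hk
  obtain ⟨n, hn⟩ := hS.exists_notMem
  have h0 : 0 < epoch (fun n => D n ω) (n + 1) := by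
    simpa using strictMono_epoch hpos (Nat.succ_pos n)
  refine ⟨n + 1, ?_⟩
  by_contra hlt
  exact hn ⟨h0, (not_lt.1 hlt).trans hm.le⟩

/-- Mixing Poisson laws over an exponential rate gives a geometric law. -/
lemma lintegral_poissonMeasure_expMeasure {r a : ℝ} (hr : 0 < r) (ha : 0 ≤ a) (k : ℕ) :
    ∫⁻ α, poissonMeasure (Real.toNNReal (α * a)) {k} ∂(expMeasure r) =
      ENNReal.ofReal (r * a ^ k / (r + a) ^ (k + 1)) := by
  have hra : 0 < r + a := by positivity
  have hpdf : Measurable (gammaPDF 1 r) := (measurable_gammaPDFReal 1 r).ennreal_ofReal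
  rw [expMeasure, gammaMeasure, lintegral_withDensity_eq_lintegral_mul _ hpdf
    (measurable_poissonMeasure_singleton a k)]
  -- The Poisson weight times the exponential density is a constant times the Gamma density of shape
  -- k + 1 and rate r + a, whose total mass is 1.
  have key : ∀ α, (gammaPDF 1 r * fun α => poissonMeasure (Real.toNNReal (α * a)) {k}) α =
      ENNReal.ofReal (r * a ^ k / (r + a) ^ (k + 1)) * gammaPDF (k + 1) (r + a) α := by
    intro α
    rw [Pi.mul_apply, poissonMeasure_singleton, gammaPDF_eq, gammaPDF_eq]
    split_ifs with hα
    · rw [Real.coe_toNNReal _ (by positivity), ← ENNReal.ofReal_mul' (by positivity),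
        ← ENNReal.ofReal_mul (by positivity), Real.Gamma_nat_eq_factorial, Real.Gamma_one]
      congr 1
      rw [add_sub_cancel_right, Real.rpow_natCast, sub_self, Real.rpow_zero, Real.rpow_one,
        show ((k : ℝ) + 1) = ((k + 1 : ℕ) : ℝ) by push_cast; rfl, Real.rpow_natCast,
        show -((r + a) * α) = -(r * α) + -(α * a) by ring, Real.exp_add, mul_pow]
      field_simp
    · simp
  simp_rw [key]
  have hpdf' : Measurable (gammaPDF (k + 1) (r + a)) :=
    (measurable_gammaPDFReal _ _).ennreal_ofReal
  rw [lintegral_const_mul _ hpdf',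
    lintegral_gammaPDF_eq_one (by positivity) hra, mul_one]

lemma IsGCP.measureReal_counting [IsProbabilityMeasure P] {lam : ℝ} (hlam : 0 < lam)
    (h : IsGCP P lam D) {a : ℝ} (ha : 0 ≤ a) (k : ℕ) :
    P.real {ω | counting (fun n => D n ω) a = k} =
      (1 - lam * a / (1 + lam * a)) * (lam * a / (1 + lam * a)) ^ k := by
  have : IsProbabilityMeasure (expMeasure (1 / lam)) :=
    isProbabilityMeasure_expMeasure (by positivity)
  have hE := IsMixedPoisson.measure_epochCount h le_rfl ha k
  rw [sub_zero, lintegral_poissonMeasure_expMeasure (by positivity) ha] at hE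
  have hae : P {ω | counting (fun n => D n ω) a = k} =
      P {ω | epochCount (fun n => D n ω) 0 a = k} := by
    refine measure_congr ?_
    filter_upwards [IsMixedPoisson.ae_isProperDurations h] with ω hω
    refine propext ?_
    change counting _ a = k ↔ epochCount _ 0 a = k
    rw [counting_eq_toNat_epochCount hω.pos]
    have hne : epochCount (fun n => D n ω) 0 a ≠ ⊤ := by
      obtain ⟨m, hm⟩ := hω.exists_lt a
      refine Set.encard_ne_top_iff.2 ((Set.finite_Iio m).subset fun n hn => ?_)
      have := (strictMono_epoch hω.pos).lt_iff_lt.1 (hn.2.trans_lt hm)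
      exact Set.mem_Iio.2 (by omega)
    rw [← ENat.natCast_toNat hne]
    simp
  rw [measureReal_def, hae, hE, ENNReal.toReal_ofReal (by positivity)]
  have h1 : 1 / lam + a = (1 + lam * a) / lam := by field_simp
  have h2 : 1 - lam * a / (1 + lam * a) = 1 / (1 + lam * a) := by
    have : 1 + lam * a ≠ 0 := by positivity
    field_simp
    ring
  rw [h1, h2, div_pow, div_pow, mul_pow, pow_succ, pow_succ]
  field_simp

/-- Summing P(X = k) P(Y ≥ k) = (1 - p)(pq)^k over `k`. -/
lemma measureReal_le_geometric [IsProbabilityMeasure P] {X Y : Ω → ℕ} (hX : Measurable X)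
    (hY : Measurable Y) (hXY : IndepFun X Y P) {p q : ℝ} (hp : 0 ≤ p) (hp1 : p < 1) (hq : 0 ≤ q)
    (hq1 : q < 1) (hXp : ∀ k, P.real {ω | X ω = k} = (1 - p) * p ^ k)
    (hYq : ∀ k, P.real {ω | Y ω = k} = (1 - q) * q ^ k) :
    P.real {ω | X ω ≤ Y ω} = (1 - p) / (1 - p * q) := by
  have hYge : ∀ k, P.real {ω | k ≤ Y ω} = q ^ k := by
    intro k
    induction k with
    | zero => simp
    | succ k ih =>
      have hsplit : {ω | k ≤ Y ω} = {ω | Y ω = k} ∪ {ω | k + 1 ≤ Y ω} := by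
        ext ω
        simp only [Set.mem_ofPred_eq, Set.mem_union]
        omega
      have hdisj : Disjoint {ω | Y ω = k} {ω | k + 1 ≤ Y ω} :=
        Set.disjoint_left.2 fun ω h1 h2 => by
          simp only [Set.mem_ofPred_eq] at h1 h2
          omega
      rw [hsplit, measureReal_union hdisj (hY (Set.to_countable (Set.Ici (k + 1))).measurableSet),
        hYq] at ih
      rw [pow_succ]
      linarith
  have hmeas : ∀ k, MeasurableSet {ω | X ω = k ∧ k ≤ Y ω} := fun k =>
    (hX (measurableSet_singleton k)).inter (hY (Set.to_countable (Set.Ici k)).measurableSet)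
  have hU : {ω | X ω ≤ Y ω} = ⋃ k, {ω | X ω = k ∧ k ≤ Y ω} := by
    ext ω; simp
  have hpq : p * q < 1 := by nlinarith
  have hsum : HasSum (fun k => P.real {ω | X ω = k ∧ k ≤ Y ω}) (P.real {ω | X ω ≤ Y ω}) := by
    rw [hU]
    have hd : Pairwise (Function.onFun Disjoint fun k => {ω | X ω = k ∧ k ≤ Y ω}) := by
      intro i j hij
      exact Set.disjoint_left.2 fun ω h1 h2 => hij (h1.1.symm.trans h2.1)
    simp only [measureReal_def]
    rw [measure_iUnion hd hmeas, ENNReal.tsum_toReal_eq fun k => measure_ne_top _ _]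
    refine (ENNReal.summable_toReal ?_).hasSum
    rw [← measure_iUnion hd hmeas]
    exact measure_ne_top _ _
  have hterm : ∀ k, P.real {ω | X ω = k ∧ k ≤ Y ω} = (1 - p) * (p * q) ^ k := by
    intro k
    have := congrArg ENNReal.toReal (hXY.measure_inter_preimage_eq_mul {k} (Set.Ici k)
      (measurableSet_singleton k) (Set.to_countable _).measurableSet)
    rw [ENNReal.toReal_mul] at this
    simp only [← measureReal_def] at this
    have h1 : P.real (X ⁻¹' {k}) = (1 - p) * p ^ k := hXp k
    have h2 : P.real (Y ⁻¹' Set.Ici k) = q ^ k := hYge k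
    rw [h1, h2] at this
    rw [mul_pow, ← mul_assoc, ← this]
    rfl
  simp_rw [hterm] at hsum
  exact hsum.unique ((hasSum_geometric_of_lt_one (by positivity) hpq).mul_left _)

/-- The tail formula for the expectation of a function of a bounded nonnegative variable. -/
lemma integral_comp_eq_integral_tail [IsProbabilityMeasure P] {Y : Ω → ℝ} (hY : Measurable Y)
    {t : ℝ} (ht : 0 ≤ t) (hYt : ∀ᵐ ω ∂P, Y ω ∈ Set.Icc 0 t) {g φ φ' : ℝ → ℝ}
    (hg : ∀ᵐ x, x ∈ Set.Ioo 0 t → P.real {ω | x ≤ Y ω} = g x)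
    (hφ : ∀ x ∈ Set.Icc 0 t, HasDerivAt φ (φ' x) x) (hφ' : ContinuousOn φ' (Set.Icc 0 t)) :
    ∫ ω, φ (Y ω) ∂P = φ 0 + ∫ x in 0..t, g x * φ' x := by
  have hint : IntegrableOn φ' (Set.Ioc 0 t) := hφ'.integrableOn_Icc.mono_set Set.Ioc_subset_Icc_self
  have hS : MeasurableSet {p : Ω × ℝ | p.2 ≤ Y p.1} :=
    measurableSet_le measurable_snd (hY.comp measurable_fst)
  -- Fubini applied to φ(Y) = φ(0) + ∫₀ᵗ 1{x ≤ Y} φ'(x) dx.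
  set f : Ω → ℝ → ℝ := fun ω x => {p : Ω × ℝ | p.2 ≤ Y p.1}.indicator (fun p => φ' p.2) (ω, x)
  have hf : Integrable (Function.uncurry f) (P.prod (volume.restrict (Set.Ioc 0 t))) :=
    Integrable.indicator (Integrable.comp_snd hint P) hS
  have hpt : ∀ᵐ ω ∂P, φ (Y ω) = φ 0 + ∫ x in Set.Ioc 0 t, f ω x := by
    filter_upwards [hYt] with ω hω
    have h1 : ∫ x in Set.Ioc 0 t, f ω x = ∫ x in Set.Ioc 0 (Y ω), φ' x := by
      have : f ω = (Set.Iic (Y ω)).indicator φ' := by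
        ext x
        rfl
      rw [this, setIntegral_indicator measurableSet_Iic]
      congr 2
      ext x
      simp only [Set.mem_inter_iff, Set.mem_Ioc, Set.mem_Iic]
      constructor
      · rintro ⟨⟨a, b⟩, c⟩; exact ⟨a, c⟩
      · rintro ⟨a, c⟩; exact ⟨⟨a, c.trans hω.2⟩, c⟩
    have hsub : Set.uIcc 0 (Y ω) ⊆ Set.Icc 0 t := by
      rw [Set.uIcc_of_le hω.1]
      exact Set.Icc_subset_Icc_right hω.2
    rw [h1, ← intervalIntegral.integral_of_le hω.1,
      intervalIntegral.integral_eq_sub_of_hasDerivAt (fun x hx => hφ x (hsub hx))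
        (hφ'.mono hsub).intervalIntegrable]
    ring
  have hf' : Integrable (fun ω => ∫ x in Set.Ioc 0 t, f ω x) P := hf.integral_prod_left
  rw [integral_congr_ae hpt, integral_add (integrable_const _) hf',
    integral_integral_swap hf, intervalIntegral.integral_of_le ht]
  simp only [integral_const, probReal_univ, one_smul]
  congr 1
  rw [← restrict_Ioo_eq_restrict_Ioc]
  refine setIntegral_congr_ae measurableSet_Ioo ?_
  filter_upwards [hg] with x hx hxt
  have : (fun ω => f ω x) = {ω | x ≤ Y ω}.indicator fun _ => φ' x := by
    ext ω
    rfl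
  rw [this, integral_indicator_const _ (measurableSet_le measurable_const hY), hx hxt, smul_eq_mul]

variable {lam : ℝ} {V : Fin 2 → ℕ → Ω → ℝ}

lemma measurable_of_isGCP (hV : ∀ i, IsGCP P lam (V i)) : Measurable fun ω i n => V i n ω :=
  measurable_pi_lambda _ fun i => IsMixedPoisson.measurable_durations (hV i)

variable [IsProbabilityMeasure P]

/-- The two implications of `initialPhaseTime_spec` squeeze the event between A > a and A ≥ a, which
have equal probability for almost every `a`; that is all the tail formula needs. -/
lemma measureReal_le_initialPhaseTime (hlam : 0 < lam) (hV : ∀ i, IsGCP P lam (V i))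
    (hind : IndepFun (fun ω n => V 0 n ω) (fun ω n => V 1 n ω) P) (j : Fin 2) {s : ℝ} :
    ∀ᵐ a, a ∈ Set.Ioo 0 s → P.real {ω | a ≤ initialPhaseTime j (fun i n => V i n ω) s} =
      (1 + lam * (s - a)) / (1 + lam * s) := by
  filter_upwards [meas_le_ae_eq_meas_lt P volume
    fun ω => initialPhaseTime j (fun i n => V i n ω) s] with a ha has
  have has0 : 0 ≤ s - a := sub_nonneg.2 has.2.le
  have hprob : IsProbabilityMeasure (expMeasure (1 / lam)) :=
    isProbabilityMeasure_expMeasure (by positivity)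
  have hind' : IndepFun (fun ω n => V j n ω) (fun ω n => V (j + 1) n ω) P := by
    obtain rfl | rfl : j = 0 ∨ j = 1 := by omega
    · exact hind
    · rw [show (1 + 1 : Fin 2) = 0 from rfl]
      exact hind.symm
  have hmc : ∀ a, Measurable fun d : ℕ → ℝ => counting d a := fun a =>
    Measurable.of_uncurry_right (f := counting) measurable_counting
  have hgeo := measureReal_le_geometric
    ((hmc a).comp (IsMixedPoisson.measurable_durations (hV j)))
    ((hmc (s - a)).comp (IsMixedPoisson.measurable_durations (hV (j + 1))))
    (hind'.comp (hmc a) (hmc (s - a))) (p := lam * a / (1 + lam * a))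
    (q := lam * (s - a) / (1 + lam * (s - a)))
    (by have := has.1; positivity) (by have := has.1; rw [div_lt_one (by positivity)]; linarith)
    (by positivity) (by rw [div_lt_one (by positivity)]; linarith)
    ((hV j).measureReal_counting hlam has.1.le) ((hV (j + 1)).measureReal_counting hlam has0)
  have hspec : ∀ᵐ ω ∂P, (a < initialPhaseTime j (fun i n => V i n ω) s →
      counting (fun n => V j n ω) a ≤ counting (fun n => V (j + 1) n ω) (s - a)) ∧
      (counting (fun n => V j n ω) a ≤ counting (fun n => V (j + 1) n ω) (s - a) →
        a ≤ initialPhaseTime j (fun i n => V i n ω) s) := by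
    filter_upwards [ae_all_iff.2 fun i => IsMixedPoisson.ae_isProperDurations (hV i)] with ω hω
    exact initialPhaseTime_spec (j := j) hω has.1.le has.2.le
  have hle : P {ω | a ≤ initialPhaseTime j (fun i n => V i n ω) s} =
      P {ω | counting (fun n => V j n ω) a ≤ counting (fun n => V (j + 1) n ω) (s - a)} := by
    refine le_antisymm ?_ ?_
    · rw [ha]
      refine measure_mono_ae ?_
      filter_upwards [hspec] with ω hω
      exact hω.1
    · refine measure_mono_ae ?_
      filter_upwards [hspec] with ω hω
      exact hω.2
  rw [measureReal_def, hle]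
  refine hgeo.trans ?_
  have h1 : 0 < 1 + lam * a := by have := has.1; positivity
  have h2 : 0 < 1 + lam * (s - a) := by positivity
  have h3 : 0 < 1 + lam * s := by nlinarith
  have h4 : 1 - lam * a / (1 + lam * a) * (lam * (s - a) / (1 + lam * (s - a))) =
      (1 + lam * s) / ((1 + lam * a) * (1 + lam * (s - a))) := by
    field_simp
    ring
  have h5 : 1 - lam * a / (1 + lam * a) = 1 / (1 + lam * a) := by
    field_simp
    ring
  rw [h4, h5]
  field_simp

lemma integral_comp_initialPhaseTime (hlam : 0 < lam) (hV : ∀ i, IsGCP P lam (V i))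
    (hind : IndepFun (fun ω n => V 0 n ω) (fun ω n => V 1 n ω) P) (j : Fin 2) {s : ℝ}
    (hs : 0 ≤ s) {φ φ' : ℝ → ℝ} (hφ : ∀ x, HasDerivAt φ (φ' x) x) (hφ' : Continuous φ') :
    ∫ ω, φ (initialPhaseTime j (fun i n => V i n ω) s) ∂P =
      φ 0 + ∫ a in 0..s, (1 + lam * (s - a)) / (1 + lam * s) * φ' a :=
  integral_comp_eq_integral_tail
    ((measurable_initialPhaseTime j).comp ((measurable_of_isGCP hV).prodMk measurable_const)) hs
    (Filter.Eventually.of_forall fun _ => initialPhaseTime_mem_Icc _ _ hs)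
    (measureReal_le_initialPhaseTime hlam hV hind j) (fun x _ => hφ x) hφ'.continuousOn

lemma integral_telegraphPosition (hlam : 0 < lam) (hV : ∀ i, IsGCP P lam (V i))
    (hind : IndepFun (fun ω n => V 0 n ω) (fun ω n => V 1 n ω) P) (v₁ v₂ : ℝ) (j : Fin 2)
    {vj vj' : ℝ} (hvj : vj = if j = 0 then v₁ else v₂) (hvj' : vj' = if j = 0 then v₂ else v₁)
    {s : ℝ} (hs : 0 ≤ s) :
    ∫ ω, telegraphPosition v₁ v₂ j (fun i n => V i n ω) s ∂P =
      (v₁ + v₂) / 2 * s + (vj - vj') / 2 * (s / (1 + lam * s)) := by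
  have hsum : v₁ + v₂ = vj + vj' := by
    rw [hvj, hvj']; split_ifs <;> ring
  simp_rw [telegraphPosition_eq, ← hvj, ← hvj']
  have h := integral_comp_initialPhaseTime hlam hV hind j hs
    (φ := fun x => vj' * s + (vj - vj') * x) (φ' := fun _ => vj - vj')
    (fun x => by simpa using ((hasDerivAt_id x).const_mul (vj - vj')).const_add (vj' * s))
    continuous_const
  rw [h]
  have hpos : 0 < 1 + lam * s := by positivity
  have hF : ∫ a in 0..s, (1 + lam * (s - a)) / (1 + lam * s) * (vj - vj') =
      (vj - vj') / (1 + lam * s) * (s + lam * s * s - lam * s ^ 2 / 2) -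
      (vj - vj') / (1 + lam * s) * (0 + lam * s * 0 - lam * 0 ^ 2 / 2) := by
    refine intervalIntegral.integral_eq_sub_of_hasDerivAt
      (f := fun a => (vj - vj') / (1 + lam * s) * (a + lam * s * a - lam * a ^ 2 / 2))
      (fun x _ => ?_) (Continuous.intervalIntegrable (by fun_prop) _ _)
    have := ((((hasDerivAt_id x).add ((hasDerivAt_id x).const_mul (lam * s))).sub
      (((hasDerivAt_pow 2 x).const_mul lam).div_const 2)).const_mul ((vj - vj') / (1 + lam * s)))
    refine this.congr_deriv ?_
    push_cast
    field_simp
    ring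
  rw [hF, hsum]
  field_simp
  ring

lemma integral_telegraphPosition_sq (hlam : 0 < lam) (hV : ∀ i, IsGCP P lam (V i))
    (hind : IndepFun (fun ω n => V 0 n ω) (fun ω n => V 1 n ω) P) (v₁ v₂ : ℝ) (j : Fin 2)
    {vj vj' : ℝ} (hvj : vj = if j = 0 then v₁ else v₂) (hvj' : vj' = if j = 0 then v₂ else v₁)
    {s : ℝ} (hs : 0 ≤ s) :
    ∫ ω, telegraphPosition v₁ v₂ j (fun i n => V i n ω) s ^ 2 ∂P =
      (v₁ ^ 2 + v₁ * v₂ + v₂ ^ 2) / 3 * s ^ 2 +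
        (2 * vj ^ 2 - v₁ * v₂ - vj' ^ 2) / 3 * (s ^ 2 / (1 + lam * s)) := by
  have hsum : v₁ ^ 2 + v₁ * v₂ + v₂ ^ 2 = vj ^ 2 + vj * vj' + vj' ^ 2 := by
    rw [hvj, hvj']; split_ifs <;> ring
  have hprod : v₁ * v₂ = vj * vj' := by
    rw [hvj, hvj']; split_ifs <;> ring
  rw [hsum, hprod]
  simp_rw [telegraphPosition_eq, ← hvj, ← hvj']
  have h := integral_comp_initialPhaseTime hlam hV hind j hs
    (φ := fun x => (vj' * s + (vj - vj') * x) ^ 2)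
    (φ' := fun x => 2 * (vj' * s + (vj - vj') * x) * (vj - vj'))
    (fun x => by
      simpa using (((hasDerivAt_id x).const_mul (vj - vj')).const_add (vj' * s)).fun_pow 2)
    (by fun_prop)
  rw [h]
  have hpos : 0 < 1 + lam * s := by positivity
  -- Antiderivative in `a`, with coefficients read off by expanding the product of the linear tail
  -- and the linear derivative.
  set F : ℝ → ℝ := fun a => 2 * (vj - vj') / (1 + lam * s) * ((1 + lam * s) * (vj' * s) * a +
    ((1 + lam * s) * (vj - vj') - lam * (vj' * s)) * (a ^ 2 / 2) -
    lam * (vj - vj') * (a ^ 3 / 3)) with hFdef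
  have hF : ∫ a in 0..s, (1 + lam * (s - a)) / (1 + lam * s) *
      (2 * (vj' * s + (vj - vj') * a) * (vj - vj')) = F s - F 0 := by
    refine intervalIntegral.integral_eq_sub_of_hasDerivAt
      (fun x _ => ?_) (Continuous.intervalIntegrable (by fun_prop) _ _)
    have := (((((hasDerivAt_id x).const_mul ((1 + lam * s) * (vj' * s))).add
      (((hasDerivAt_pow 2 x).div_const 2).const_mul
        ((1 + lam * s) * (vj - vj') - lam * (vj' * s)))).sub
      (((hasDerivAt_pow 3 x).div_const 3).const_mul (lam * (vj - vj')))).const_mul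
        (2 * (vj - vj') / (1 + lam * s)))
    refine this.congr_deriv ?_
    push_cast
    field_simp
    ring
  rw [hF, hFdef]
  field_simp
  ring

end

end

/-! ### The motion with resets: averaging over the age. -/

noncomputable section

section

variable {Ω : Type*} [MeasurableSpace Ω] {P : Measure Ω} {lam ξ : ℝ}

/-- The time elapsed at time `t` since the last epoch. -/
def epochAge (r : ℕ → ℝ) (t : ℝ) : ℝ := t - epoch r (counting r t)

lemma resetPosition_eq (v₁ v₂ : ℝ) (j : Fin 2) (r : ℕ → ℝ) (u : ℕ → Fin 2 → ℕ → ℝ) (t : ℝ) :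
    resetPosition v₁ v₂ j r u t =
      telegraphPosition v₁ v₂ j (u (counting r t)) (epochAge r t) := rfl

lemma measurable_counting_left (t : ℝ) : Measurable fun r : ℕ → ℝ => counting r t :=
  Measurable.of_uncurry_right (f := counting) measurable_counting

lemma measurable_epochAge (t : ℝ) : Measurable fun r : ℕ → ℝ => epochAge r t := by
  have h : Measurable fun q : ℕ × (ℕ → ℝ) => epoch q.2 q.1 :=
    measurable_from_prod_countable_right fun n => measurable_epoch n
  exact measurable_const.sub (h.comp ((measurable_counting_left t).prodMk measurable_id))

lemma IsProperDurations.epochAge_mem_Icc {r : ℕ → ℝ} (hr : IsProperDurations r) {t : ℝ}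
    (ht : 0 ≤ t) : epochAge r t ∈ Set.Icc 0 t :=
  ⟨sub_nonneg.2 (hr.epoch_counting_le ht), sub_le_self _ (epoch_nonneg hr.pos _)⟩

lemma measurable_telegraphPosition (v₁ v₂ : ℝ) (j : Fin 2) :
    Measurable fun p : (Fin 2 → ℕ → ℝ) × ℝ => telegraphPosition v₁ v₂ j p.1 p.2 := by
  simp_rw [telegraphPosition_eq]
  exact (measurable_snd.const_mul _).add ((measurable_initialPhaseTime j).const_mul _)

/-- With A the time in the initial velocity, the position is x A + y (s - A) with both weights in
[0, t]. The bound is uniform over paths and yields integrability of all powers. -/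
lemma abs_telegraphPosition_le (v₁ v₂ : ℝ) (j : Fin 2) (u : Fin 2 → ℕ → ℝ) {s t : ℝ}
    (hs : s ∈ Set.Icc 0 t) : |telegraphPosition v₁ v₂ j u s| ≤ (|v₁| + |v₂|) * t := by
  obtain ⟨h0, h1⟩ := initialPhaseTime_mem_Icc j u hs.1
  rw [telegraphPosition_eq]
  set A := initialPhaseTime j u s
  set x := if j = 0 then v₁ else v₂ with hx
  set y := if j = 0 then v₂ else v₁ with hy
  have hxy : |v₁| + |v₂| = |x| + |y| := by
    rw [hx, hy]
    split_ifs
    exacts [rfl, add_comm _ _]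
  rw [hxy, show y * s + (x - y) * A = x * A + y * (s - A) by ring]
  refine (abs_add_le _ _).trans ?_
  rw [abs_mul, abs_mul, abs_of_nonneg h0, abs_of_nonneg (sub_nonneg.2 h1), add_mul]
  exact add_le_add (mul_le_mul_of_nonneg_left (h1.trans hs.2) (abs_nonneg _))
    (mul_le_mul_of_nonneg_left (by linarith [hs.2]) (abs_nonneg _))

variable {R : ℕ → Ω → ℝ} {U : ℕ → Fin 2 → ℕ → Ω → ℝ}

/-- The motion is selected by a random index, but the index set is countable, so measurability for
each fixed index suffices. -/
lemma IsResetTelegraph.measurable_resetPosition (h : IsResetTelegraph P lam ξ R U)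
    (v₁ v₂ : ℝ) (j : Fin 2) (t : ℝ) :
    Measurable fun ω => resetPosition v₁ v₂ j (fun n => R n ω) (fun k i n => U k i n ω) t := by
  have hR := IsMixedPoisson.measurable_durations h.resets
  have hB : Measurable fun ω => epochAge (fun n => R n ω) t := (measurable_epochAge t).comp hR
  have hF : Measurable fun q : ℕ × Ω => telegraphPosition v₁ v₂ j (fun i n => U q.1 i n q.2)
      (epochAge (fun n => R n q.2) t) :=
    measurable_from_prod_countable_right fun k => Measurable.comp
      (g := fun p : (Fin 2 → ℕ → ℝ) × ℝ => telegraphPosition v₁ v₂ j p.1 p.2)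
      (f := fun ω => (fun i n => U k i n ω, epochAge (fun n => R n ω) t))
      (measurable_telegraphPosition v₁ v₂ j) ((measurable_of_isGCP (h.gcp k)).prodMk hB)
  have hK : Measurable fun ω => counting (fun n => R n ω) t := (measurable_counting_left t).comp hR
  simp_rw [resetPosition_eq]
  exact Measurable.comp
    (g := fun q : ℕ × Ω => telegraphPosition v₁ v₂ j (fun i n => U q.1 i n q.2)
      (epochAge (fun n => R n q.2) t))
    (f := fun ω => (counting (fun n => R n ω) t, ω)) hF (hK.prodMk measurable_id)

variable [IsProbabilityMeasure P]

/-- The age is at least `s` exactly when no reset falls in (t - s, t], a Poisson void event. -/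
lemma IsPoissonProcess.measureReal_le_epochAge (hξ : 0 < ξ)
    (hR : IsPoissonProcess P ξ R) {s t : ℝ} (hs : 0 ≤ s) (hst : s ≤ t) :
    P.real {ω | s ≤ epochAge (fun n => R n ω) t} = Real.exp (-ξ * s) := by
  have h := IsMixedPoisson.measure_epochCount hR (sub_nonneg.2 hst) (sub_le_self t hs) 0
  rw [lintegral_dirac, poissonMeasure_singleton, Real.coe_toNNReal _ (by
    rw [sub_sub_cancel]; positivity), sub_sub_cancel] at h
  have hae : P {ω | s ≤ epochAge (fun n => R n ω) t} =
      P {ω | epochCount (fun n => R n ω) (t - s) t = (0 : ℕ)} := by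
    refine measure_congr ?_
    filter_upwards [IsMixedPoisson.ae_isProperDurations hR] with ω hω
    refine propext ?_
    change s ≤ t - epoch _ _ ↔ epochCount _ _ _ = ((0 : ℕ) : ℕ∞)
    rw [Nat.cast_zero, hω.epochCount_eq_zero_iff (sub_nonneg.2 hst) (sub_le_self t hs),
      le_sub_comm]
  rw [measureReal_def, hae, h, ENNReal.toReal_ofReal (by positivity)]
  simp

lemma IsResetTelegraph.ae_abs_resetPosition_le (h : IsResetTelegraph P lam ξ R U)
    (v₁ v₂ : ℝ) (j : Fin 2) {t : ℝ} (ht : 0 ≤ t) :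
    ∀ᵐ ω ∂P, |resetPosition v₁ v₂ j (fun n => R n ω) (fun k i n => U k i n ω) t| ≤
      (|v₁| + |v₂|) * t := by
  filter_upwards [IsMixedPoisson.ae_isProperDurations h.resets] with ω hω
  exact abs_telegraphPosition_le v₁ v₂ j _ (hω.epochAge_mem_Icc ht)

lemma IsResetTelegraph.integrable_pow (h : IsResetTelegraph P lam ξ R U)
    (v₁ v₂ : ℝ) (j : Fin 2) {t : ℝ} (ht : 0 ≤ t) (p : ℕ) :
    Integrable (fun ω =>
      resetPosition v₁ v₂ j (fun n => R n ω) (fun k i n => U k i n ω) t ^ p) P := by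
  refine Integrable.of_bound ((h.measurable_resetPosition v₁ v₂ j t).pow_const p).aestronglyMeasurable
    (((|v₁| + |v₂|) * t) ^ p) ?_
  filter_upwards [h.ae_abs_resetPosition_le v₁ v₂ j ht] with ω hω
  rw [Real.norm_eq_abs, abs_pow]
  exact pow_le_pow_left₀ (abs_nonneg _) hω p

/-- The moments of the process with resets are obtained by averaging those of the process without
resets over the time elapsed since the last reset. -/
lemma IsResetTelegraph.integral_pow (h : IsResetTelegraph P lam ξ R U)
    (v₁ v₂ : ℝ) (j : Fin 2) {t : ℝ} (ht : 0 ≤ t) (p : ℕ) {m : ℝ → ℝ} (hm : Measurable m)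
    (hmU : ∀ k, ∀ s ∈ Set.Icc 0 t,
      ∫ ω, telegraphPosition v₁ v₂ j (fun i n => U k i n ω) s ^ p ∂P = m s) :
    ∫ ω, resetPosition v₁ v₂ j (fun n => R n ω) (fun k i n => U k i n ω) t ^ p ∂P =
      ∫ ω, m (epochAge (fun n => R n ω) t) ∂P := by
  set C := ((|v₁| + |v₂|) * t) ^ p with hC
  have hbd : ∀ u, ∀ s ∈ Set.Icc 0 t, ‖telegraphPosition v₁ v₂ j u s ^ p‖ ≤ C := by
    intro u s hs
    rw [Real.norm_eq_abs, abs_pow]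
    exact pow_le_pow_left₀ (abs_nonneg _) (abs_telegraphPosition_le v₁ v₂ j u hs) p
  have hmbd : ∀ s ∈ Set.Icc 0 t, ‖m s‖ ≤ C := by
    intro s hs
    rw [← hmU 0 s hs]
    simpa using norm_integral_le_of_norm_le_const (μ := P)
      (Filter.Eventually.of_forall fun ω => hbd (fun i n => U 0 i n ω) s hs)
  have hR : Measurable fun ω n => R n ω := IsMixedPoisson.measurable_durations h.resets
  have hproper := IsMixedPoisson.ae_isProperDurations h.resets
  have hmint : Integrable (fun ω => m (epochAge (fun n => R n ω) t)) P := by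
    refine Integrable.of_bound
      (hm.comp ((measurable_epochAge t).comp hR)).aestronglyMeasurable C ?_
    filter_upwards [hproper] with ω hω
    exact hmbd _ (hω.epochAge_mem_Icc ht)
  set K : Ω → ℕ := fun ω => counting (fun n => R n ω) t with hK
  have hKm : Measurable K := (measurable_counting_left t).comp hR
  have hpart : ∀ {f : Ω → ℝ}, Integrable f P →
      HasSum (fun k => ∫ ω in {ω | K ω = k}, f ω ∂P) (∫ ω, f ω ∂P) := by
    intro f hf
    have := hasSum_integral_iUnion (μ := P) (f := f) (s := fun k : ℕ => {ω | K ω = k})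
      (fun k => hKm (measurableSet_singleton k))
      (fun i j hij => Set.disjoint_left.2 fun ω h1 h2 => hij (h1.symm.trans h2))
      hf.integrableOn
    have hU : (⋃ k, {ω | K ω = k}) = Set.univ := by
      ext ω; simp
    rwa [hU, setIntegral_univ] at this
  refine (hpart (h.integrable_pow v₁ v₂ j ht p)).unique ?_
  -- On this event only `U k` enters, so its independence from the resets is enough and no joint law
  -- across different `k` is needed.
  have hk : ∀ k, ∫ ω in {ω | K ω = k},
      resetPosition v₁ v₂ j (fun n => R n ω) (fun k i n => U k i n ω) t ^ p ∂P =
      ∫ ω in {ω | K ω = k}, m (epochAge (fun n => R n ω) t) ∂P := by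
    intro k
    have hUk : Measurable fun ω i n => U k i n ω := measurable_of_isGCP (h.gcp k)
    -- Restricting to ages in [0, t] costs only a null set, and makes `H` bounded everywhere and
    -- `hmU` applicable for every `r` in `S`.
    set S : Set (ℕ → ℝ) := {r | counting r t = k} ∩ (fun r => epochAge r t) ⁻¹' Set.Icc 0 t with hS
    have hSm : MeasurableSet S := (measurable_counting_left t (measurableSet_singleton k)).inter
      (measurable_epochAge t measurableSet_Icc)
    set H : (ℕ → ℝ) × (Fin 2 → ℕ → ℝ) → ℝ := (Prod.fst ⁻¹' S).indicator
      fun q => telegraphPosition v₁ v₂ j q.2 (epochAge q.1 t) ^ p with hH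
    have hpre : ∀ {r : ℕ → ℝ} {u : Fin 2 → ℕ → ℝ},
        (r, u) ∈ (Prod.fst ⁻¹' S : Set ((ℕ → ℝ) × (Fin 2 → ℕ → ℝ))) ↔ r ∈ S := Iff.rfl
    have hHm : Measurable H := (((measurable_telegraphPosition v₁ v₂ j).comp
      (measurable_snd.prodMk ((measurable_epochAge t).comp measurable_fst))).pow_const p).indicator
      (measurable_fst hSm)
    have hC0 : 0 ≤ C := by positivity
    have hHbd : ∀ q, ‖H q‖ ≤ C := by
      intro q
      by_cases hq : q.1 ∈ S
      · rw [hH, Set.indicator_of_mem (hpre.2 hq)]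
        exact hbd _ _ hq.2
      · rw [hH, Set.indicator_of_notMem (fun hx => hq (hpre.1 hx)), norm_zero]
        exact hC0
    have hmem : ∀ᵐ ω ∂P, (fun n => R n ω) ∈ S ↔ K ω = k := by
      filter_upwards [hproper] with ω hω
      exact ⟨fun hx => hx.1, fun hx => ⟨hx, hω.epochAge_mem_Icc ht⟩⟩
    have hKk : MeasurableSet {ω | K ω = k} := hKm (measurableSet_singleton k)
    have : IsProbabilityMeasure (P.map fun ω n => R n ω) :=
      Measure.isProbabilityMeasure_map hR.aemeasurable
    have : IsProbabilityMeasure (P.map fun ω i n => U k i n ω) :=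
      Measure.isProbabilityMeasure_map hUk.aemeasurable
    have hprod := (indepFun_iff_map_prod_eq_prod_map_map hR.aemeasurable hUk.aemeasurable).1
      (h.indep_resets k)
    have hleft : ∫ ω in {ω | K ω = k},
        resetPosition v₁ v₂ j (fun n => R n ω) (fun k i n => U k i n ω) t ^ p ∂P =
        ∫ ω, H (fun n => R n ω, fun i n => U k i n ω) ∂P := by
      rw [← integral_indicator hKk]
      refine integral_congr_ae ?_
      filter_upwards [hmem] with ω hω
      by_cases hωk : K ω = k
      · rw [Set.indicator_of_mem (show ω ∈ {ω | K ω = k} from hωk), hH,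
          Set.indicator_of_mem (hpre.2 (hω.2 hωk))]
        have hωk' : counting (fun n => R n ω) t = k := hωk
        rw [resetPosition_eq, hωk']
      · rw [Set.indicator_of_notMem (show ω ∉ {ω | K ω = k} from hωk), hH,
          Set.indicator_of_notMem fun hx => hωk (hω.1 (hpre.1 hx))]
    have hright : ∫ ω in {ω | K ω = k}, m (epochAge (fun n => R n ω) t) ∂P =
        ∫ ω, S.indicator (fun r => m (epochAge r t)) (fun n => R n ω) ∂P := by
      rw [← integral_indicator hKk]
      refine integral_congr_ae ?_
      filter_upwards [hmem] with ω hω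
      by_cases hωk : K ω = k
      · rw [Set.indicator_of_mem (show ω ∈ {ω | K ω = k} from hωk),
          Set.indicator_of_mem (hω.2 hωk)]
      · rw [Set.indicator_of_notMem (show ω ∉ {ω | K ω = k} from hωk),
          Set.indicator_of_notMem (fun hx => hωk (hω.1 hx))]
    -- With the resets frozen, integrating out the motion leaves the free moment at the age.
    have hinner : ∀ r, ∫ u, H (r, u) ∂(P.map fun ω i n => U k i n ω) =
        S.indicator (fun r => m (epochAge r t)) r := by
      intro r
      rw [integral_map (f := fun u => H (r, u)) hUk.aemeasurable (hHm.comp measurable_prodMk_left).aestronglyMeasurable]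
      by_cases hr : r ∈ S
      · rw [Set.indicator_of_mem hr, ← hmU k _ hr.2]
        refine integral_congr_ae (Filter.Eventually.of_forall fun ω => ?_)
        change H _ = _
        rw [hH, Set.indicator_of_mem (hpre.2 hr)]
      · rw [Set.indicator_of_notMem hr]
        refine integral_eq_zero_of_ae (Filter.Eventually.of_forall fun ω => ?_)
        change H _ = _
        rw [hH, Set.indicator_of_notMem (fun hx => hr (hpre.1 hx))]
        rfl
    rw [hleft, hright, ← integral_map (f := H) (hR.prodMk hUk).aemeasurable hHm.aestronglyMeasurable,
      hprod, integral_prod _ (Integrable.of_bound hHm.aestronglyMeasurable C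
        (Filter.Eventually.of_forall hHbd))]
    simp_rw [hinner]
    exact integral_map hR.aemeasurable
      ((hm.comp (measurable_epochAge t)).indicator hSm).aestronglyMeasurable
  simp_rw [hk]
  exact hpart hmint

/-- The moments with resets, once an antiderivative of `exp (-ξ s) m' s` is known. -/
lemma IsResetTelegraph.integral_pow_eq_of_hasDerivAt (h : IsResetTelegraph P lam ξ R U)
    (hξ : 0 < ξ) (v₁ v₂ : ℝ) (j : Fin 2) {t : ℝ} (ht : 0 ≤ t) (p : ℕ) {m m' F : ℝ → ℝ}
    (hm : Measurable m)
    (hmU : ∀ k, ∀ s ∈ Set.Icc 0 t,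
      ∫ ω, telegraphPosition v₁ v₂ j (fun i n => U k i n ω) s ^ p ∂P = m s)
    (hm0 : m 0 = 0) (hmd : ∀ s ∈ Set.Icc 0 t, HasDerivAt m (m' s) s)
    (hmc : ContinuousOn m' (Set.Icc 0 t))
    (hF : ∀ s ∈ Set.Icc 0 t, HasDerivAt F (Real.exp (-ξ * s) * m' s) s) (hF0 : F 0 = 0) :
    ∫ ω, resetPosition v₁ v₂ j (fun n => R n ω) (fun k i n => U k i n ω) t ^ p ∂P = F t := by
  have hR := IsMixedPoisson.measurable_durations h.resets
  rw [h.integral_pow v₁ v₂ j ht p hm hmU,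
    integral_comp_eq_integral_tail (Y := fun ω => epochAge (fun n => R n ω) t)
      (g := fun s => Real.exp (-ξ * s)) ((measurable_epochAge t).comp hR) ht
      ((IsMixedPoisson.ae_isProperDurations h.resets).mono fun ω hω => hω.epochAge_mem_Icc ht)
      (Filter.Eventually.of_forall fun s hs =>
        h.resets.measureReal_le_epochAge hξ hs.1.le hs.2.le) hmd hmc, hm0,
    intervalIntegral.integral_eq_sub_of_hasDerivAt (f := F)]
  · rw [hF0]; ring
  · rwa [Set.uIcc_of_le ht]
  · refine ContinuousOn.intervalIntegrable ?_
    rw [Set.uIcc_of_le ht]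
    exact ContinuousOn.mul (Continuous.continuousOn (by fun_prop)) hmc

end

/-! ### Closed forms by differentiation. -/

/-- The upper limit is z = ξ/λ + ξs, so the chain rule gives ξ z⁻¹ exp(-z). The factor exp(-ξ/λ)
split off here is what exp(ξ/λ) cancels in the final formulas. -/
lemma hasDerivAt_genIncGamma_zero {lam ξ s : ℝ} (hlam : 0 < lam) (hξ : 0 < ξ) (hs : 0 ≤ s) :
    HasDerivAt (fun s => genIncGamma 0 (ξ / lam) (ξ / lam * (1 + lam * s)))
      (lam / (1 + lam * s) * Real.exp (-ξ * s) / Real.exp (ξ / lam)) s := by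
  have hz : 0 < ξ / lam := by positivity
  have hz1 : 0 < ξ / lam * (1 + lam * s) := by positivity
  have hcont : ContinuousOn (fun u : ℝ => u ^ ((0 : ℝ) - 1) * Real.exp (-u)) (Set.Ioi 0) :=
    ContinuousOn.mul (continuousOn_id.rpow_const fun x hx => Or.inl (ne_of_gt hx))
      (Continuous.continuousOn (by fun_prop))
  have hsub : Set.uIcc (ξ / lam) (ξ / lam * (1 + lam * s)) ⊆ Set.Ioi 0 := fun x hx =>
    (lt_min hz hz1).trans_le hx.1
  have hmeas : Measurable fun u : ℝ => u ^ ((0 : ℝ) - 1) * Real.exp (-u) := by fun_prop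
  have h1 := intervalIntegral.integral_hasDerivAt_right (hcont.mono hsub).intervalIntegrable
    hmeas.stronglyMeasurable.stronglyMeasurableAtFilter (hcont.continuousAt (Ioi_mem_nhds hz1))
  have h2 : HasDerivAt (fun s => ξ / lam * (1 + lam * s)) (ξ / lam * (lam * 1)) s :=
    (((hasDerivAt_id s).const_mul lam).const_add 1).const_mul (ξ / lam)
  refine (h1.comp s h2).congr_deriv ?_
  have hpos : 0 < 1 + lam * s := by positivity
  rw [zero_sub, Real.rpow_neg_one, show -(ξ / lam * (1 + lam * s)) = -ξ * s - ξ / lam by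
    field_simp; ring, Real.exp_sub]
  field_simp

end

theorem mainTheorem5 {Ω : Type*} [MeasurableSpace Ω] (P : Measure Ω) [IsProbabilityMeasure P]
    (lam ξ : ℝ) (hlam : 0 < lam) (hξ : 0 < ξ) (v₁ v₂ : ℝ) (hv : v₂ < v₁)
    (R : ℕ → Ω → ℝ) (U : ℕ → Fin 2 → ℕ → Ω → ℝ) (h : IsResetTelegraph P lam ξ R U)
    (t : ℝ) (ht : 0 < t) (j : Fin 2) (vj vj' : ℝ)
    (hvj : vj = if j = 0 then v₁ else v₂) (hvj' : vj' = if j = 0 then v₂ else v₁)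
    (X : Ω → ℝ)
    (hX : X = fun ω => resetPosition v₁ v₂ j (fun n => R n ω) (fun k i n => U k i n ω) t)
    (G : ℝ) (hG : G = genIncGamma 0 (ξ / lam) (ξ / lam * (1 + lam * t))) :
    (Integrable X P ∧
      ∫ ω, X ω ∂P =
        (1 - Real.exp (-ξ * t)) * ((v₁ + v₂) / (2 * ξ) + (vj - vj') / (2 * lam))
          - ξ * Real.exp (ξ / lam) * (vj - vj') / (2 * lam ^ 2) * G
          + t * Real.exp (-ξ * t) * (vj - vj') / (2 * (1 + lam * t))) ∧
    (Integrable (fun ω => X ω ^ 2) P ∧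
      ∫ ω, X ω ^ 2 ∂P =
        (1 - Real.exp (-ξ * t)) *
            (2 * (v₁ ^ 2 + v₁ * v₂ + v₂ ^ 2) / (3 * ξ ^ 2)
              + (2 * vj ^ 2 - v₁ * v₂ - vj' ^ 2) / (3 * lam) * (1 / ξ - 1 / lam))
          - t * Real.exp (-ξ * t) *
            (2 * (v₁ ^ 2 + v₁ * v₂ + v₂ ^ 2) / (3 * ξ)
              + (2 * vj ^ 2 - v₁ * v₂ - vj' ^ 2) / (3 * lam * (1 + lam * t)))
          + ξ * Real.exp (ξ / lam) * (2 * vj ^ 2 - v₁ * v₂ - vj' ^ 2) / (3 * lam ^ 3) * G) := by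
  have hden : ∀ s ∈ Set.Icc 0 t, 1 + lam * s ≠ 0 := fun s hs => by
    have := hs.1
    positivity
  have hG' : ∀ s ∈ Set.Icc 0 t, _ := fun s hs => hasDerivAt_genIncGamma_zero hlam hξ hs.1
  have hexp : ∀ s : ℝ, HasDerivAt (fun s => Real.exp (-ξ * s)) (Real.exp (-ξ * s) * (-ξ * 1)) s :=
    fun s => ((hasDerivAt_id s).const_mul (-ξ)).exp
  have hlin : ∀ s : ℝ, HasDerivAt (fun s => 1 + lam * s) (lam * 1) s :=
    fun s => ((hasDerivAt_id s).const_mul lam).const_add 1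
  have hG0 : genIncGamma 0 (ξ / lam) (ξ / lam * (1 + lam * 0)) = 0 := by
    simp [genIncGamma]
  refine ⟨⟨?_, ?_⟩, ?_, ?_⟩
  · simpa [hX] using h.integrable_pow v₁ v₂ j ht.le 1
  -- `F` is the claimed value with `t` replaced by a variable `s`. Integrating exp(-ξs)/(1+λs)² by
  -- parts produces both the boundary term and the incomplete Gamma term.
  · have key := h.integral_pow_eq_of_hasDerivAt hξ v₁ v₂ j ht.le 1
      (m := fun s => (v₁ + v₂) / 2 * s + (vj - vj') / 2 * (s / (1 + lam * s)))
      (m' := fun s => (v₁ + v₂) / 2 + (vj - vj') / 2 * (1 / (1 + lam * s) ^ 2))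
      (F := fun s => (1 - Real.exp (-ξ * s)) * ((v₁ + v₂) / (2 * ξ) + (vj - vj') / (2 * lam))
          - ξ * Real.exp (ξ / lam) * (vj - vj') / (2 * lam ^ 2) *
            genIncGamma 0 (ξ / lam) (ξ / lam * (1 + lam * s))
          + s * Real.exp (-ξ * s) * (vj - vj') / (2 * (1 + lam * s)))
      (by fun_prop)
      (fun k s hs => by
        simpa using integral_telegraphPosition hlam (h.gcp k) (h.indep_gcp k) v₁ v₂ j hvj hvj' hs.1)
      (by simp)
      (fun s hs => by
        have hd := hden s hs
        refine (((hasDerivAt_id s).const_mul ((v₁ + v₂) / 2)).add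
          (((hasDerivAt_id s).div (hlin s) hd).const_mul ((vj - vj') / 2))).congr_deriv ?_
        simp only [id]
        field_simp
        ring)
      (by
        refine continuousOn_const.add (continuousOn_const.mul (continuousOn_const.div
          (Continuous.continuousOn (by fun_prop)) fun s hs => pow_ne_zero 2 (hden s hs))))
      (fun s hs => by
        have hd := hden s hs
        refine (((((hexp s).const_sub 1).mul_const _).sub ((hG' s hs).const_mul _)).add
          ((((hasDerivAt_id s).mul (hexp s)).mul_const (vj - vj')).div ((hlin s).const_mul 2)
            (mul_ne_zero two_ne_zero hd))).congr_deriv ?_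
        have hd' : 1 + s * lam ≠ 0 := by rwa [mul_comm s]
        simp only [id, Pi.mul_apply]
        field_simp
        ring)
      (by simp only [hG0]; simp)
    rw [hX, hG]
    simpa using key
  · simpa only [hX] using h.integrable_pow v₁ v₂ j ht.le 2
  -- The same integral reappears because (2s + λs²)/(1+λs)² = (1 - 1/(1+λs)²)/λ, which explains the
  -- extra 1/λ and the opposite sign of the Gamma term.
  · have key := h.integral_pow_eq_of_hasDerivAt hξ v₁ v₂ j ht.le 2
      (m := fun s => (v₁ ^ 2 + v₁ * v₂ + v₂ ^ 2) / 3 * s ^ 2 +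
        (2 * vj ^ 2 - v₁ * v₂ - vj' ^ 2) / 3 * (s ^ 2 / (1 + lam * s)))
      (m' := fun s => (v₁ ^ 2 + v₁ * v₂ + v₂ ^ 2) / 3 * (2 * s) +
        (2 * vj ^ 2 - v₁ * v₂ - vj' ^ 2) / 3 * ((2 * s + lam * s ^ 2) / (1 + lam * s) ^ 2))
      (F := fun s => (1 - Real.exp (-ξ * s)) *
            (2 * (v₁ ^ 2 + v₁ * v₂ + v₂ ^ 2) / (3 * ξ ^ 2)
              + (2 * vj ^ 2 - v₁ * v₂ - vj' ^ 2) / (3 * lam) * (1 / ξ - 1 / lam))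
          - s * Real.exp (-ξ * s) *
            (2 * (v₁ ^ 2 + v₁ * v₂ + v₂ ^ 2) / (3 * ξ)
              + (2 * vj ^ 2 - v₁ * v₂ - vj' ^ 2) / (3 * lam * (1 + lam * s)))
          + ξ * Real.exp (ξ / lam) * (2 * vj ^ 2 - v₁ * v₂ - vj' ^ 2) / (3 * lam ^ 3) *
            genIncGamma 0 (ξ / lam) (ξ / lam * (1 + lam * s)))
      (by fun_prop)
      (fun k s hs =>
        integral_telegraphPosition_sq hlam (h.gcp k) (h.indep_gcp k) v₁ v₂ j hvj hvj' hs.1)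
      (by simp)
      (fun s hs => by
        have hd := hden s hs
        refine (((hasDerivAt_pow 2 s).const_mul _).add
          (((hasDerivAt_pow 2 s).div (hlin s) hd).const_mul _)).congr_deriv ?_
        push_cast
        field_simp
        ring)
      (by
        refine (Continuous.continuousOn (by fun_prop)).add (continuousOn_const.mul
          (ContinuousOn.div (Continuous.continuousOn (by fun_prop))
            (Continuous.continuousOn (by fun_prop)) fun s hs => pow_ne_zero 2 (hden s hs))))
      (fun s hs => by
        have hd := hden s hs
        have hd3 : 3 * lam * (1 + lam * s) ≠ 0 := mul_ne_zero (by positivity) hd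
        refine (((((hexp s).const_sub 1).mul_const _).sub (((hasDerivAt_id s).mul (hexp s)).mul
          (((hasDerivAt_const s (2 * vj ^ 2 - v₁ * v₂ - vj' ^ 2)).div
            ((hlin s).const_mul (3 * lam)) hd3).const_add _))).add
          ((hG' s hs).const_mul _)).congr_deriv ?_
        have hd' : 1 + s * lam ≠ 0 := by rwa [mul_comm s]
        simp only [id, Pi.mul_apply, Pi.div_apply]
        field_simp
        ring)
      (by simp only [hG0]; simp)
    rw [hX, hG]
    exact key
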